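/- Let $n\ge 1$ and let $S_n\subseteq S_{n+1}$ be the natural embedding (permutations fixing the last point), with group algebras $R=\mathbb{C}S_n\subseteq H=\mathbb{C}S_{n+1}$. Conventions. For modules $M,N$ over a ring write $M\,\|\,N$ if $M\oplus P\cong N$ for some module $P$, and write $M\sim N$ ($M$ and $N$ are similar) if $M\,\|\,qN$ and $N\,\|\,rM$ for some $q,r\in\mathbb{N}$, where $qN=N\oplus\cdots\oplus N$ ($q$ summands). A subalgebra $B\subseteq A$ has h-depth $2m-1$ ($m\ge 1$) if $A^{\otimes_B(m+1)}\sim A^{\otimes_B m}$ as $A$-$A$-bimodules; $d_h(B,A)$ is the minimum h-depth. For a group $G$ let $\mathcal{M}_G$ be the category of finite-dimensional right $\mathbb{C}G$-modules, with tensor product over $\mathbb{C}$ and diagonal action. For $W\in\mathcal{M}_G$ put $T_0(W)=\mathbb{C}$ (the trivial module) and $T_m(W)=W\oplus W^{\otimes 2}\oplus\cdots\oplus W^{\otimes m}$ for $m\ge 1$; the module $W$ has depth $m\ge 0$ if $T_{m+1}(W)\,\|\,q\,T_m(W)$ for some $q\in\mathbb{N}$, and $d(W,\mathcal{M}_G)$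 is the minimum depth. Let $V=H/R^+H$, where $R^+$ is the kernel of the counit (augmentation) of $R$; this is the permutation module $\mathbb{C}[S_n\backslash S_{n+1}]$ on right cosets, a right $S_{n+1}$-module and by restriction a right $S_n$-module. Then $$d_h(\mathbb{C}S_n,\mathbb{C}S_{n+1})=2n+1,\qquad d(V,\mathcal{M}_{S_n})=n-1,\qquad d(V,\mathcal{M}_{S_{n+1}})=n.$$ -/

import Mathlib

open scoped TensorProduct

noncomputable section

universe v

namespace SubalgebraDepth

/-! ### Divisibility and similarity of modules -/

/-- `M ∣ N`: there is a module `P` with `M ⊕ P ≅ N`. -/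
def Divides (R : Type*) [Ring R] (M : Type*) [AddCommGroup M] [Module R M]
    (N : Type v) [AddCommGroup N] [Module R N] : Prop :=
  ∃ (P : Type v) (_ : AddCommGroup P) (_ : Module R P), Nonempty ((M × P) ≃ₗ[R] N)

/-- `M` divides a multiple `q N = N ⊕ ⋯ ⊕ N` of `N`. -/
def DividesMultiple (R : Type*) [Ring R] (M : Type*) [AddCommGroup M] [Module R M]
    (N : Type*) [AddCommGroup N] [Module R N] : Prop :=
  ∃ q : ℕ, Divides R M (Fin q → N)

/-- Similarity `M ∼ N`: each of the two modules divides a multiple of the other. -/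
def Similar (R : Type*) [Ring R] (M : Type*) [AddCommGroup M] [Module R M]
    (N : Type*) [AddCommGroup N] [Module R N] : Prop :=
  DividesMultiple R M N ∧ DividesMultiple R N M

/-! ### The `A`-`A`-bimodules `A ⊗_B ⋯ ⊗_B A` and the h-depth of a subalgebra -/

section HDepth

variable {k A : Type*} [Field k] [Ring A] [Algebra k A]

/-- The relations
`a₀ ⊗ ⋯ ⊗ aᵢ b ⊗ aᵢ₊₁ ⊗ ⋯ ⊗ aⱼ = a₀ ⊗ ⋯ ⊗ aᵢ ⊗ b aᵢ₊₁ ⊗ ⋯ ⊗ aⱼ` (`b ∈ B`)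
in the `(j+1)`-fold tensor power of `A` over the ground field. -/
def balancedRel (B : Subalgebra k A) (j : ℕ) : Submodule k (⨂[k]^(j + 1) A) :=
  Submodule.span k {t | ∃ (x : Fin (j + 1) → A) (i : Fin j) (b : A), b ∈ B ∧
    t = PiTensorProduct.tprod k (Function.update x i.castSucc (x i.castSucc * b)) -
        PiTensorProduct.tprod k (Function.update x i.succ (b * x i.succ))}

/-- `BalancedPower B j` is `A ⊗_B ⋯ ⊗_B A` with `j + 1` factors `A` (so with `j` signs `⊗_B`). -/
def BalancedPower (B : Subalgebra k A) (j : ℕ) : Type _ :=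
  (⨂[k]^(j + 1) A) ⧸ balancedRel B j

instance (B : Subalgebra k A) (j : ℕ) : AddCommGroup (BalancedPower B j) :=
  inferInstanceAs (AddCommGroup ((⨂[k]^(j + 1) A) ⧸ balancedRel B j))

instance (B : Subalgebra k A) (j : ℕ) : Module k (BalancedPower B j) :=
  inferInstanceAs (Module k ((⨂[k]^(j + 1) A) ⧸ balancedRel B j))

/-- A `k`-linear map acting on the tensor factor number `i` only. -/
def actAt (j : ℕ) (i : Fin (j + 1)) (f : A →ₗ[k] A) :
    (⨂[k]^(j + 1) A) →ₗ[k] (⨂[k]^(j + 1) A) :=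
  PiTensorProduct.map (Function.update (fun _ => LinearMap.id) i f)

theorem actAt_tprod (j : ℕ) (i : Fin (j + 1)) (f : A →ₗ[k] A) (x : Fin (j + 1) → A) :
    actAt j i f (PiTensorProduct.tprod k x) =
      PiTensorProduct.tprod k (Function.update x i (f (x i))) := by
  refine (PiTensorProduct.map_tprod _ _).trans (congrArg _ ?_)
  funext l
  by_cases h : l = i
  · subst h; simp
  · simp [h]

theorem left_balancedRel (B : Subalgebra k A) (j : ℕ) (a : A) :
    balancedRel B j ≤ (balancedRel B j).comap (actAt j 0 (LinearMap.mulLeft k a)) := by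
  refine Submodule.span_le.2 ?_
  rintro _ ⟨x, i, b, hb, rfl⟩
  refine Submodule.subset_span ⟨Function.update x 0 (a * x 0), i, b, hb, ?_⟩
  rw [map_sub, actAt_tprod, actAt_tprod]
  congr 2
  · funext l
    by_cases h0 : l = 0 <;> by_cases hi : i.castSucc = 0 <;> by_cases hl : l = i.castSucc <;>
      simp_all [Function.update_apply, mul_assoc]
  · funext l
    by_cases h0 : l = 0 <;> by_cases hl : l = i.succ <;>
      simp_all [Function.update_apply, (Fin.succ_ne_zero i).symm, Fin.succ_ne_zero i]

theorem right_balancedRel (B : Subalgebra k A) (j : ℕ) (a : A) :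
    balancedRel B j ≤
      (balancedRel B j).comap (actAt j (Fin.last j) (LinearMap.mulRight k a)) := by
  refine Submodule.span_le.2 ?_
  rintro _ ⟨x, i, b, hb, rfl⟩
  refine Submodule.subset_span
    ⟨Function.update x (Fin.last j) (x (Fin.last j) * a), i, b, hb, ?_⟩
  rw [map_sub, actAt_tprod, actAt_tprod]
  congr 2
  · funext l
    by_cases h0 : l = Fin.last j <;> by_cases hl : l = i.castSucc <;>
      simp_all [Function.update_apply, (Fin.castSucc_ne_last i).symm,
        Fin.castSucc_ne_last i]
  · funext l
    by_cases h0 : l = Fin.last j <;> by_cases hi : i.succ = Fin.last j <;>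
      by_cases hl : l = i.succ <;> simp_all [Function.update_apply, mul_assoc]

/-- The element `x₀ ⊗_B ⋯ ⊗_B xⱼ` of `A ⊗_B ⋯ ⊗_B A`. -/
def BalancedPower.mk (B : Subalgebra k A) (j : ℕ) (x : Fin (j + 1) → A) : BalancedPower B j :=
  (balancedRel B j).mkQ (PiTensorProduct.tprod k x)

theorem BalancedPower.mk_update_add (B : Subalgebra k A) (j : ℕ) (x : Fin (j + 1) → A)
    (i : Fin (j + 1)) (a b : A) : mk B j (Function.update x i (a + b)) =
      mk B j (Function.update x i a) + mk B j (Function.update x i b) := by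
  refine (congrArg (balancedRel B j).mkQ (MultilinearMap.map_update_add _ x i a b)).trans ?_
  exact map_add (balancedRel B j).mkQ _ _

theorem BalancedPower.mk_update_smul (B : Subalgebra k A) (j : ℕ) (x : Fin (j + 1) → A)
    (i : Fin (j + 1)) (c : k) (a : A) : mk B j (Function.update x i (c • a)) =
      c • mk B j (Function.update x i a) := by
  refine (congrArg (balancedRel B j).mkQ (MultilinearMap.map_update_smul _ x i c a)).trans ?_
  exact map_smul (balancedRel B j).mkQ _ _

theorem BalancedPower.end_ext {B : Subalgebra k A} {j : ℕ}
    {f g : Module.End k (BalancedPower B j)}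
    (h : ∀ x : Fin (j + 1) → A, f (mk B j x) = g (mk B j x)) : f = g :=
  Submodule.linearMap_qext _ (PiTensorProduct.ext (MultilinearMap.ext h))

/-- Left multiplication by `a` on the first factor. -/
def leftMul (B : Subalgebra k A) (j : ℕ) (a : A) : Module.End k (BalancedPower B j) :=
  (balancedRel B j).mapQ _ (actAt j 0 (LinearMap.mulLeft k a)) (left_balancedRel B j a)

/-- Right multiplication by `a` on the last factor. -/
def rightMul (B : Subalgebra k A) (j : ℕ) (a : A) : Module.End k (BalancedPower B j) :=
  (balancedRel B j).mapQ _ (actAt j (Fin.last j) (LinearMap.mulRight k a))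
    (right_balancedRel B j a)

theorem leftMul_mk (B : Subalgebra k A) (j : ℕ) (a : A) (x : Fin (j + 1) → A) :
    leftMul B j a (BalancedPower.mk B j x) =
      BalancedPower.mk B j (Function.update x 0 (a * x 0)) :=
  congrArg (balancedRel B j).mkQ (actAt_tprod j 0 (LinearMap.mulLeft k a) x)

theorem rightMul_mk (B : Subalgebra k A) (j : ℕ) (a : A) (x : Fin (j + 1) → A) :
    rightMul B j a (BalancedPower.mk B j x) =
      BalancedPower.mk B j (Function.update x (Fin.last j) (x (Fin.last j) * a)) :=
  congrArg (balancedRel B j).mkQ (actAt_tprod j (Fin.last j) (LinearMap.mulRight k a) x)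

/-- The left `A`-action on `A ⊗_B ⋯ ⊗_B A`. -/
def leftAct (B : Subalgebra k A) (j : ℕ) : A →ₐ[k] Module.End k (BalancedPower B j) :=
  AlgHom.ofLinearMap
    { toFun := leftMul B j
      map_add' := fun a b => BalancedPower.end_ext fun x => by
        simp only [LinearMap.add_apply, leftMul_mk, add_mul, BalancedPower.mk_update_add]
      map_smul' := fun c a => BalancedPower.end_ext fun x => by
        simp only [LinearMap.smul_apply, leftMul_mk, smul_mul_assoc,
          BalancedPower.mk_update_smul, RingHom.id_apply] }
    (BalancedPower.end_ext fun x => by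
      change leftMul B j 1 _ = _
      simp [leftMul_mk])
    (fun a b => BalancedPower.end_ext fun x => by
      rw [Module.End.mul_apply]
      change leftMul B j (a * b) _ = leftMul B j a (leftMul B j b _)
      simp [leftMul_mk, mul_assoc])

/-- The right `A`-action on `A ⊗_B ⋯ ⊗_B A`. -/
def rightAct (B : Subalgebra k A) (j : ℕ) : Aᵐᵒᵖ →ₐ[k] Module.End k (BalancedPower B j) :=
  AlgHom.ofLinearMap
    { toFun := fun a => rightMul B j a.unop
      map_add' := fun a b => BalancedPower.end_ext fun x => by
        simp only [LinearMap.add_apply, rightMul_mk, MulOpposite.unop_add, mul_add,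
          BalancedPower.mk_update_add]
      map_smul' := fun c a => BalancedPower.end_ext fun x => by
        simp only [LinearMap.smul_apply, rightMul_mk, MulOpposite.unop_smul, mul_smul_comm,
          BalancedPower.mk_update_smul, RingHom.id_apply] }
    (BalancedPower.end_ext fun x => by
      change rightMul B j 1 _ = _
      simp [rightMul_mk])
    (fun a b => BalancedPower.end_ext fun x => by
      rw [Module.End.mul_apply]
      change rightMul B j (b.unop * a.unop) _ = rightMul B j a.unop (rightMul B j b.unop _)
      simp [rightMul_mk, mul_assoc])

theorem leftAct_commute_rightAct (B : Subalgebra k A) (j : ℕ) (a : A) (b : Aᵐᵒᵖ) :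
    Commute (leftAct B j a) (rightAct B j b) :=
  BalancedPower.end_ext fun x => by
    rw [Module.End.mul_apply, Module.End.mul_apply]
    change leftMul B j a (rightMul B j b.unop _) = rightMul B j b.unop (leftMul B j a _)
    rw [rightMul_mk, leftMul_mk, leftMul_mk, rightMul_mk]
    congr 1
    funext l
    by_cases h : (0 : Fin (j + 1)) = Fin.last j
    · simp [← h, mul_assoc]
    · by_cases h0 : l = 0 <;> by_cases hl : l = Fin.last j <;>
        simp_all [Ne.symm h]

/-- `A ⊗_B ⋯ ⊗_B A` as an `A`-`A`-bimodule, that is as a module over the enveloping algebra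
`A ⊗ Aᵒᵖ`, where `a ⊗ c` acts by `t ↦ a t c`. -/
instance (B : Subalgebra k A) (j : ℕ) : Module (A ⊗[k] Aᵐᵒᵖ) (BalancedPower B j) :=
  Module.compHom (BalancedPower B j)
    (Algebra.TensorProduct.lift (leftAct B j) (rightAct B j)
      (leftAct_commute_rightAct B j)).toRingHom

/-- `B ⊆ A` has h-depth `2m - 1` (`m ≥ 1`) if the `A`-`A`-bimodules `A ⊗_B ⋯ ⊗_B A` with `m + 1`
and with `m` factors are similar. Here `m = j + 1`, so that `2m - 1 = 2j + 1`. -/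
def HasHDepth (B : Subalgebra k A) (d : ℕ) : Prop :=
  ∃ j : ℕ, d = 2 * j + 1 ∧
    Similar (A ⊗[k] Aᵐᵒᵖ) (BalancedPower B (j + 1)) (BalancedPower B j)

/-- `d` is the minimum h-depth `d_h(B, A)` of the subalgebra `B` of `A`. -/
def IsMinHDepth (B : Subalgebra k A) (d : ℕ) : Prop :=
  IsLeast {e : ℕ | HasHDepth B e} d

end HDepth

/-! ### Depth of a module over a group algebra

A right `k[G]`-module is a representation of the opposite group `Gᵐᵒᵖ`, and the tensor product
in the category of right `k[G]`-modules carries the diagonal action of `G`. The definitions below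
are for representations of an arbitrary group and are applied to opposite groups. -/

section ModuleDepth

variable {k G W : Type*} [Field k] [Group G] [AddCommGroup W] [Module k W]

/-- The tensor power `W ⊗ ⋯ ⊗ W` (`m` factors, the trivial module `k` for `m = 0`) with the
diagonal action of `G`. -/
def tensorPowerRep (ρ : Representation k G W) (m : ℕ) : Representation k G (⨂[k]^m W) where
  toFun g := PiTensorProduct.map fun _ => ρ g
  map_one' := by
    rw [map_one]
    exact PiTensorProduct.map_one
  map_mul' g h := by
    rw [map_mul]
    exact PiTensorProduct.map_mul (fun _ => ρ g) (fun _ => ρ h)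

/-- The exponents that occur in the truncated tensor algebra: `1, …, n` for `n ≥ 1`, and only
`0` for `n = 0`. -/
def truncExponents (n : ℕ) : Finset ℕ :=
  if n = 0 then {0} else Finset.Icc 1 n

/-- The truncated tensor algebra `T_n(W) = W ⊕ (W ⊗ W) ⊕ ⋯ ⊕ W^{⊗ n}` for `n ≥ 1`, and
`T_0(W) = k`, as a module over the group algebra of `G`. -/
abbrev TruncatedTensor (ρ : Representation k G W) (n : ℕ) : Type _ :=
  ∀ i : truncExponents n, (tensorPowerRep ρ i).asModule

/-- `W` has depth `n` if `T_{n+1}(W)` divides a multiple of `T_n(W)`. -/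
def HasModuleDepth (ρ : Representation k G W) (n : ℕ) : Prop :=
  DividesMultiple (MonoidAlgebra k G) (TruncatedTensor ρ (n + 1)) (TruncatedTensor ρ n)

/-- `n` is the minimum depth of `W`. -/
def IsMinModuleDepth (ρ : Representation k G W) (n : ℕ) : Prop :=
  IsLeast {m : ℕ | HasModuleDepth ρ m} n

end ModuleDepth

/-! ### The permutation module `V = H / R⁺H` for `H = k[G]` -/

section PermutationModule

variable {k G : Type*} [Field k] [Group G]

/-- `R⁺H`, where `R⁺` is the kernel of the counit of `H = k[G]` restricted to `R`. -/
def augmentationMul (R : Subalgebra k (MonoidAlgebra k G)) :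
    Submodule k (MonoidAlgebra k G) :=
  (Subalgebra.toSubmodule R ⊓
    LinearMap.ker (Coalgebra.counit : MonoidAlgebra k G →ₗ[k] k)) * ⊤

theorem augmentationMul_le_comap (R : Subalgebra k (MonoidAlgebra k G)) (h : MonoidAlgebra k G) :
    augmentationMul R ≤ (augmentationMul R).comap (LinearMap.mulRight k h) := by
  refine Submodule.mul_le.2 fun r hr x _ => ?_
  rw [Submodule.mem_comap, LinearMap.mulRight_apply, mul_assoc]
  exact Submodule.mul_mem_mul hr Submodule.mem_top

/-- The right `H`-module `V = H / R⁺H` for `H = k[G]`, given by the right action of `G`, that is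
by a representation of the opposite group: `g` sends the class of `h` to the class of `h g`. -/
def permutationModule (R : Subalgebra k (MonoidAlgebra k G)) :
    Representation k Gᵐᵒᵖ (MonoidAlgebra k G ⧸ augmentationMul R) where
  toFun g := (augmentationMul R).mapQ _
    (LinearMap.mulRight k (MonoidAlgebra.of k G g.unop)) (augmentationMul_le_comap R _)
  map_one' := by
    refine Submodule.linearMap_qext _ (LinearMap.ext fun x => ?_)
    simp [← MonoidAlgebra.one_def]
  map_mul' g h := by
    refine Submodule.linearMap_qext _ (LinearMap.ext fun x => ?_)
    simp [mul_assoc]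

end PermutationModule

/-! ### The symmetric group algebras `ℂ S_n ⊆ ℂ S_{n+1}` -/

/-- The natural embedding `S_n → S_{n+1}`: permutations are extended by fixing the last point. -/
def symEmb (n : ℕ) : Equiv.Perm (Fin n) →* Equiv.Perm (Fin (n + 1)) :=
  Equiv.Perm.viaEmbeddingHom Fin.castSuccEmb

/-- `ℂ S_n` as a subalgebra of `ℂ S_{n+1}`. -/
def symSubalgebra (n : ℕ) : Subalgebra ℂ (MonoidAlgebra ℂ (Equiv.Perm (Fin (n + 1)))) :=
  (MonoidAlgebra.mapDomainAlgHom ℂ ℂ (symEmb n)).range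

/-- The permutation module `V` of `ℂ S_n ⊆ ℂ S_{n+1}`, as a right `S_{n+1}`-module. -/
def symPerm (n : ℕ) : Representation ℂ (Equiv.Perm (Fin (n + 1)))ᵐᵒᵖ
    (MonoidAlgebra ℂ (Equiv.Perm (Fin (n + 1))) ⧸ augmentationMul (symSubalgebra n)) :=
  permutationModule (symSubalgebra n)

/-- The permutation module `V` of `ℂ S_n ⊆ ℂ S_{n+1}`, restricted to a right `S_n`-module. -/
def symPermRes (n : ℕ) : Representation ℂ (Equiv.Perm (Fin n))ᵐᵒᵖ
    (MonoidAlgebra ℂ (Equiv.Perm (Fin (n + 1))) ⧸ augmentationMul (symSubalgebra n)) :=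
  (symPerm n).comp (MonoidHom.op (symEmb n))

end SubalgebraDepth

end

open scoped TensorProduct

namespace SubalgebraDepth

open Module Equiv

/-! ### Divisibility of modules -/

section Divisibility

variable {R M N : Type*} [Ring R] [AddCommGroup M] [Module R M] [AddCommGroup N] [Module R N]

/-! All three depths follow from two tests for "`M` divides a multiple of `N`". Upper bounds: over a
semisimple ring, an element of `N` with trivial annihilator embeds the ring in `N`; the embedding
splits, so every finitely generated module divides a multiple of `N`
(`dividesMultiple_of_injective_smul`). Lower bounds: whatever annihilates `N` also annihilates every
divisor of a multiple of `N`.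

The module `V` has the `n + 1` points as a permuted basis, and `V^{⊗m}` has the `m`-tuples of
points. A tuple with trivial stabilizer spans a free cyclic submodule. Over `S_{n+1}`, `n` distinct
points suffice, because the last image is forced; over `S_n`, `n - 1` of the moved points suffice.
Conversely, let the symmetric group on `m + 2` points act. A tuple of length at most `m` misses two
of them and is fixed by their transposition, so the antisymmetrizer kills it; but `m + 1` of these
points have trivial stabilizer and are not killed. This excludes depth `m` as long as `m + 2` points
are available to permute.

For the h-depth, sending `g₀ ⊗ ⋯ ⊗ gⱼ` to the points `g₀ ⋯ gᵢ(n + 1)`, `i < j`, together with the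
product `g₀ ⋯ gⱼ` compares the balanced power with the permutation bimodule on (`j`-tuples of
points) × `S_{n+1}`. With `j ≥ n` there is a free orbit for the two-sided action. With `j < n`,
right multiplication by the sum of all group elements averages out the group coordinate, and the
antisymmetrizer on `j + 2` points again separates `j`-tuples from `(j + 1)`-tuples. -/

theorem DividesMultiple.smul_eq_zero (h : DividesMultiple R M N) {a : R}
    (ha : ∀ y : N, a • y = 0) (x : M) : a • x = 0 := by
  obtain ⟨q, P, _, _, ⟨e⟩⟩ := h
  have h0 : e (a • (x, 0)) = 0 := by
    rw [map_smul]
    funext i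
    exact ha _
  exact congrArg Prod.fst ((map_eq_zero_iff e e.injective).1 h0)

/-- Over a semisimple ring, a module with an element of trivial annihilator has every finitely
generated module as a direct summand of one of its multiples. -/
theorem dividesMultiple_of_injective_smul [IsSemisimpleRing R] [Module.Finite R M] (y : N)
    (hy : Function.Injective fun r : R => r • y) : DividesMultiple R M N := by
  -- A retraction `r` of `a ↦ a • y` exhibits the ring as a quotient of `N`.
  obtain ⟨r, hr⟩ := IsSemisimpleModule.extension_property
    (LinearMap.toSpanSingleton R N y) hy (LinearMap.id : R →ₗ[R] R)
  have hrs : Function.Surjective r := fun a => ⟨a • y, LinearMap.congr_fun hr a⟩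
  obtain ⟨q, f, hf⟩ := Module.Finite.exists_fin' R M
  let F : (Fin q → N) →ₗ[R] M := f ∘ₗ r.compLeft (Fin q)
  have hF : Function.Surjective F := hf.comp hrs.comp_left
  -- Semisimplicity splits the surjection from `q N` onto `M`.
  obtain ⟨C, hC⟩ := exists_isCompl (LinearMap.ker F)
  exact ⟨q, LinearMap.ker F, inferInstance, inferInstance,
    ⟨(((F.quotKerEquivOfSurjective hF).symm ≪≫ₗ
      Submodule.quotientEquivOfIsCompl _ C hC).prodCongr (LinearEquiv.refl R _)) ≪≫ₗ
      Submodule.prodEquivOfIsCompl C _ hC.symm⟩⟩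

end Divisibility

theorem span_range_of (k Γ : Type*) [Field k] [Monoid Γ] :
    Submodule.span k (Set.range fun g : Γ => MonoidAlgebra.of k Γ g) = ⊤ := by
  rw [← (MonoidAlgebra.basis Γ k).span_eq]
  congr 2

/-! ### Antisymmetrizers -/

section Antisymmetrizer

variable {k Γ : Type*} [Field k] [Group Γ] {N : ℕ}

/-- The signed sum of the elements of a symmetric group mapping to `Γ`. -/
noncomputable def antisymmetrizer (k : Type*) [Field k] (ψ : Perm (Fin N) →* Γ) :
    MonoidAlgebra k Γ :=
  ∑ σ : Perm (Fin N), ((Perm.sign σ : ℤ) : k) • MonoidAlgebra.of k Γ (ψ σ)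

/-- Right translation by a transposition permutes the terms and reverses every sign. -/
theorem antisymmetrizer_mul_swap (ψ : Perm (Fin N) →* Γ) {a b : Fin N} (hab : a ≠ b) :
    antisymmetrizer k ψ * MonoidAlgebra.of k Γ (ψ (swap a b)) = -antisymmetrizer k ψ := by
  rw [antisymmetrizer, Finset.sum_mul, ← Finset.sum_neg_distrib]
  refine Fintype.sum_equiv (Equiv.mulRight (swap a b)) _ _ fun σ => ?_
  simp [Perm.sign_swap hab, ← map_mul, MonoidAlgebra.single_mul_single]

/-- The antisymmetrizer kills every vector that is fixed by a transposition. -/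
theorem antisymmetrizer_apply_eq_zero [CharZero k] {W : Type*} [AddCommGroup W] [Module k W]
    (ψ : Perm (Fin N) →* Γ) {a b : Fin N} (hab : a ≠ b)
    (f : MonoidAlgebra k Γ →ₐ[k] Module.End k W) {w : W}
    (hw : f (MonoidAlgebra.of k Γ (ψ (swap a b))) w = w) : f (antisymmetrizer k ψ) w = 0 := by
  have h := congrArg (fun z => f z w) (antisymmetrizer_mul_swap (k := k) ψ hab)
  simp only [map_mul, map_neg, Module.End.mul_apply, hw, LinearMap.neg_apply] at h
  have h2 : (2 : k) • f (antisymmetrizer k ψ) w = 0 := by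
    rw [two_smul]
    nth_rewrite 1 [h]
    exact neg_add_cancel _
  exact (smul_eq_zero.1 h2).resolve_left two_ne_zero

/-- A tuple with at most `m` entries misses two of `m + 2` distinct points. -/
theorem exists_ne_notMem_range {X : Type*} {i m : ℕ} (him : i ≤ m) (p : Fin (m + 2) ↪ X)
    (t : Fin i → X) :
    ∃ a b : Fin (m + 2), a ≠ b ∧ p a ∉ Set.range t ∧ p b ∉ Set.range t := by
  classical
  let s := Finset.univ.filter fun a : Fin (m + 2) => p a ∉ Set.range t
  have hc : (Finset.univ.filter fun a : Fin (m + 2) => p a ∈ Set.range t).card ≤ i := by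
    rw [← Finset.card_map p]
    refine (Finset.card_le_card (t := Finset.univ.image t) ?_).trans
      (Finset.card_image_le.trans (by simp))
    intro x hx
    simp only [Finset.mem_map, Finset.mem_filter, Finset.mem_univ, true_and] at hx
    obtain ⟨a, ⟨l, hl⟩, rfl⟩ := hx
    exact Finset.mem_image.2 ⟨l, Finset.mem_univ _, hl⟩
  have hs : 1 < s.card := by
    have := Finset.card_filter_add_card_filter_not (s := (Finset.univ : Finset (Fin (m + 2))))
      (fun a => p a ∈ Set.range t)
    simp only [Finset.card_univ, Fintype.card_fin] at this
    change 1 < (Finset.univ.filter fun a : Fin (m + 2) => ¬ p a ∈ Set.range t).card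
    omega
  obtain ⟨a, ha, b, hb, hab⟩ := Finset.one_lt_card.1 hs
  exact ⟨a, b, hab, (Finset.mem_filter.1 ha).2, (Finset.mem_filter.1 hb).2⟩

/-- A transposition of two points that a tuple misses fixes the tuple. -/
theorem swap_fixes {X : Type*} {i : ℕ} {p : Fin N ↪ X} (θ : Perm (Fin N) →* Perm X)
    (hp : ∀ σ a, θ σ (p a) = p (σ a)) (hx : ∀ σ, ∀ x ∉ Set.range p, θ σ x = x)
    {t : Fin i → X} {a b : Fin N} (ha : p a ∉ Set.range t) (hb : p b ∉ Set.range t)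
    (l : Fin i) : θ (swap a b) (t l) = t l := by
  by_cases h : t l ∈ Set.range p
  · obtain ⟨c, hc⟩ := h
    rw [← hc, hp, swap_apply_of_ne_of_ne]
    · rintro rfl; exact ha ⟨l, hc.symm⟩
    · rintro rfl; exact hb ⟨l, hc.symm⟩
  · exact hx _ _ h

/-- The remaining point has nowhere else to go. This saving of one point fixes the exact value of
each depth. -/
theorem perm_eq_one_of_castSucc {m : ℕ} {σ : Perm (Fin (m + 1))}
    (h : ∀ i : Fin m, σ i.castSucc = i.castSucc) : σ = 1 := by
  ext x
  refine Fin.lastCases ?_ (fun i => ?_) x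
  · by_contra hne
    have hne' : σ (Fin.last m) ≠ Fin.last m := fun h => hne (by rw [h]; rfl)
    obtain ⟨y, hy⟩ := Fin.exists_castSucc_eq.2 hne'
    have := σ.injective ((h y).trans hy)
    exact Fin.castSucc_ne_last y this
  · rw [h]; rfl

end Antisymmetrizer

/-! ### Depth of permutation modules -/

section PermutationBasis

variable {k Γ W X : Type*} [Field k] [Group Γ] [AddCommGroup W] [Module k W]
  {ρ : Representation k Γ W} {b : Basis X k W} {φ : Γ →* Perm X}

/-- The basis of a tensor power indexed by tuples. -/
noncomputable def tupleBasis (b : Basis X k W) (m : ℕ) : Basis (Fin m → X) k (⨂[k]^m W) :=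
  Basis.piTensorProduct fun _ : Fin m => b

theorem tensorPowerRep_tupleBasis (h : ∀ g x, ρ g (b x) = b (φ g x))
    (m : ℕ) (g : Γ) (t : Fin m → X) :
    tensorPowerRep ρ m g (tupleBasis b m t) = tupleBasis b m (φ g ∘ t) := by
  simp only [tupleBasis, Basis.piTensorProduct_apply]
  refine (PiTensorProduct.map_tprod _ _).trans ?_
  simp [h]

theorem mem_truncExponents_self (m : ℕ) : m ∈ truncExponents m := by
  unfold truncExponents
  split_ifs with hm
  · simp [hm]
  · simp; omega

theorem le_of_mem_truncExponents {i m : ℕ} (hi : i ∈ truncExponents m) : i ≤ m := by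
  unfold truncExponents at hi
  split_ifs at hi with hm
  · simp_all
  · exact (Finset.mem_Icc.1 hi).2

/-- If some `m`-tuple of points has trivial stabilizer, then the permutation module has
depth `m`. -/
theorem hasModuleDepth_of_trivial_stabilizer [Finite Γ] [CharZero k] [Finite X]
    (h : ∀ g x, ρ g (b x) = b (φ g x)) {m : ℕ}
    (t : Fin m → X) (ht : ∀ g, φ g ∘ t = t → g = 1) : HasModuleDepth ρ m := by
  have : Module.Finite k W := Module.Finite.of_basis b
  have : NeZero (Nat.card Γ : k) := ⟨Nat.cast_ne_zero.2 Nat.card_pos.ne'⟩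
  have (i : ℕ) : Module.Finite k (⨂[k]^i W) := Module.Finite.of_basis (tupleBasis b i)
  have (i : ℕ) : Module.Finite (MonoidAlgebra k Γ) (tensorPowerRep ρ i).asModule :=
    Module.Finite.of_restrictScalars_finite k _ _
  let i₀ : truncExponents m := ⟨m, mem_truncExponents_self m⟩
  refine dividesMultiple_of_injective_smul
    (Pi.single i₀ ((tensorPowerRep ρ m).asModuleEquiv.symm (tupleBasis b m t))) ?_
  -- The translates of a tuple with trivial stabilizer are distinct basis vectors, so its orbit map
  -- is injective on the group algebra.
  have hinj : Function.Injective
      ((LinearMap.applyₗ (tupleBasis b m t)).comp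
        (tensorPowerRep ρ m).asAlgebraHom.toLinearMap) := by
    refine LinearMap.injective_of_linearIndependent
      (v := fun g : Γ => MonoidAlgebra.of k Γ g) ?_ ?_
    · exact span_range_of k Γ
    · have : (⇑((LinearMap.applyₗ (tupleBasis b m t)).comp
          (tensorPowerRep ρ m).asAlgebraHom.toLinearMap) ∘ fun g : Γ => MonoidAlgebra.of k Γ g)
          = tupleBasis b m ∘ fun g => φ g ∘ t := by
        funext g
        simp [tensorPowerRep_tupleBasis h]
      rw [this]
      refine (tupleBasis b m).linearIndependent.comp _ fun g g' hg => ?_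
      have := ht (g'⁻¹ * g) ?_
      · exact (inv_mul_eq_one.1 this).symm
      · funext l
        have := congrFun hg l
        simp_all
  intro r s hrs
  apply hinj
  have := congrFun hrs i₀
  simp only [Pi.smul_apply, Pi.single_eq_same] at this
  exact this

/-- A symmetric group on `m + 2` points acting through `Γ` prevents depth `m`. -/
theorem not_hasModuleDepth_of_symmetric [CharZero k]
    (h : ∀ g x, ρ g (b x) = b (φ g x)) {m : ℕ} (ψ : Perm (Fin (m + 2)) →* Γ)
    (p : Fin (m + 2) ↪ X) (hp : ∀ σ a, φ (ψ σ) (p a) = p (σ a))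
    (hx : ∀ σ, ∀ x ∉ Set.range p, φ (ψ σ) x = x) : ¬ HasModuleDepth ρ m := by
  intro hd
  have hkill : ∀ i ≤ m, (tensorPowerRep ρ i).asAlgebraHom (antisymmetrizer k ψ) = 0 := by
    intro i hi
    refine (tupleBasis b i).ext fun t => ?_
    obtain ⟨x, y, hxy, hx', hy'⟩ := exists_ne_notMem_range hi p t
    refine antisymmetrizer_apply_eq_zero ψ hxy _ ?_
    rw [Representation.asAlgebraHom_of, tensorPowerRep_tupleBasis h]
    congr 1
    funext l
    exact swap_fixes (φ.comp ψ) hp hx hx' hy' l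
  -- All but one of the `m + 2` points: only the identity fixes this tuple, so its coefficient in
  -- its own antisymmetrization is `1`.
  let t : Fin (m + 1) → X := fun l => p l.castSucc
  let i₀ : truncExponents (m + 1) := ⟨m + 1, mem_truncExponents_self _⟩
  have h0 := hd.smul_eq_zero (a := antisymmetrizer k ψ) ?_
    (Pi.single i₀ ((tensorPowerRep ρ (m + 1)).asModuleEquiv.symm (tupleBasis b (m + 1) t)))
  · have h1 : (tensorPowerRep ρ (m + 1)).asAlgebraHom (antisymmetrizer k ψ)
        (tupleBasis b (m + 1) t) = 0 := by
      have := congrFun h0 i₀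
      simp only [Pi.smul_apply, Pi.single_eq_same, Pi.zero_apply] at this
      exact this
    have h2 := congrArg (fun z => (tupleBasis b (m + 1)).repr z t) h1
    simp only [antisymmetrizer, map_sum, map_smul, Representation.asAlgebraHom_of,
      LinearMap.sum_apply, LinearMap.smul_apply, tensorPowerRep_tupleBasis h, Basis.repr_self,
      Finsupp.finsetSum_apply, Finsupp.smul_apply, map_zero, Finsupp.zero_apply] at h2
    rw [Finset.sum_eq_single 1] at h2
    · simp at h2
    · intro σ _ hσ
      rw [Finsupp.single_eq_of_ne, smul_zero]
      intro hc
      refine hσ (perm_eq_one_of_castSucc fun l => p.injective ?_)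
      rw [← hp]
      exact (congrFun hc l).symm
    · simp
  · intro y
    funext i
    exact LinearMap.congr_fun (hkill i (le_of_mem_truncExponents i.2)) (y i)

end PermutationBasis

/-! ### The permutation module of `ℂ S_n ⊆ ℂ S_{n+1}` -/

section SymmetricGroup

variable {n : ℕ}

theorem symEmb_castSucc (σ : Perm (Fin n)) (i : Fin n) :
    symEmb n σ i.castSucc = (σ i).castSucc :=
  Perm.viaEmbedding_apply σ Fin.castSuccEmb i

theorem symEmb_last (σ : Perm (Fin n)) : symEmb n σ (Fin.last n) = Fin.last n :=
  Perm.viaEmbedding_apply_of_notMem σ Fin.castSuccEmb _ (by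
    rintro ⟨i, hi⟩
    exact Fin.castSucc_ne_last i hi)

theorem exists_symEmb_eq {g : Perm (Fin (n + 1))} (hg : g (Fin.last n) = Fin.last n) :
    ∃ σ, symEmb n σ = g := by
  have hne (i : Fin n) : g i.castSucc ≠ Fin.last n := fun h =>
    Fin.castSucc_ne_last i (g.injective (h.trans hg.symm))
  let f : Fin n → Fin n := fun i => (g i.castSucc).castPred (hne i)
  have hf : Function.Injective f := fun i j hij =>
    Fin.castSucc_injective n (g.injective ((Fin.castPred_inj (hi := hne i) (hj := hne j)).1 hij))
  refine ⟨Equiv.ofBijective f (Finite.injective_iff_bijective.1 hf), Equiv.ext fun x => ?_⟩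
  refine Fin.lastCases ?_ (fun i => ?_) x
  · rw [symEmb_last, hg]
  · rw [symEmb_castSucc]
    simp [f]

theorem symSubalgebra_induction {p : MonoidAlgebra ℂ (Perm (Fin (n + 1))) → Prop}
    (hof : ∀ σ, p (MonoidAlgebra.of ℂ _ (symEmb n σ))) (hadd : ∀ x y, p x → p y → p (x + y))
    (hsmul : ∀ (c : ℂ) x, p x → p (c • x)) {r} (hr : r ∈ symSubalgebra n) : p r := by
  obtain ⟨r', rfl⟩ := hr
  induction r' using MonoidAlgebra.induction_on with
  | of σ => simpa using hof σ
  | add x y hx hy => rw [map_add]; exact hadd _ _ hx hy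
  | smul c x hx => simpa using hsmul c _ hx

/-- The map `ℂ S_{n+1} → ℂ^{n+1}` sending `g` to the point `g⁻¹(n + 1)`. -/
noncomputable def cosetPoint (n : ℕ) :
    MonoidAlgebra ℂ (Perm (Fin (n + 1))) →ₗ[ℂ] (Fin (n + 1) →₀ ℂ) :=
  (MonoidAlgebra.basis (Perm (Fin (n + 1))) ℂ).constr ℂ
    fun g => Finsupp.single (g⁻¹ (Fin.last n)) 1

theorem cosetPoint_of (g : Perm (Fin (n + 1))) :
    cosetPoint n (MonoidAlgebra.of ℂ _ g) = Finsupp.single (g⁻¹ (Fin.last n)) 1 :=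
  (MonoidAlgebra.basis (Perm (Fin (n + 1))) ℂ).constr_basis ℂ _ g

/-- A permutation `σ` fixing the last point satisfies `(σg)⁻¹(n + 1) = g⁻¹(n + 1)`; the rest is
linearity. Hence `cosetPoint` vanishes on `R⁺H`. -/
theorem cosetPoint_mul {r : MonoidAlgebra ℂ (Perm (Fin (n + 1)))} (hr : r ∈ symSubalgebra n)
    (x : MonoidAlgebra ℂ (Perm (Fin (n + 1)))) :
    cosetPoint n (r * x) = Coalgebra.counit (R := ℂ) r • cosetPoint n x := by
  refine symSubalgebra_induction
    (p := fun r => cosetPoint n (r * x) = Coalgebra.counit (R := ℂ) r • cosetPoint n x)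
    (fun σ => ?_) (fun y z hy hz => ?_) (fun c y hy => ?_) hr
  · induction x using MonoidAlgebra.induction_on with
    | of g =>
      have : (symEmb n σ)⁻¹ (Fin.last n) = Fin.last n := by
        rw [← map_inv, symEmb_last]
      rw [← map_mul, cosetPoint_of, cosetPoint_of, mul_inv_rev, Perm.mul_apply, this]
      simp
    | add x y hx hy => simp only [mul_add, map_add, smul_add, hx, hy]
    | smul c x hx => rw [mul_smul_comm, map_smul, map_smul, hx, smul_comm]
  · simp only [add_mul, map_add, add_smul, hy, hz]
  · simp only [smul_mul_assoc, map_smul, hy, smul_smul, smul_eq_mul]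

theorem augmentationMul_le_ker : augmentationMul (symSubalgebra n) ≤
    LinearMap.ker (cosetPoint n) := by
  refine Submodule.mul_le.2 fun r hr x _ => ?_
  rw [LinearMap.mem_ker, cosetPoint_mul hr.1, LinearMap.mem_ker.1 hr.2, zero_smul]

/-- Here `σ = g g'⁻¹` fixes the last point, so `g - g' = (σ - 1) g'` lies in `R⁺H`. -/
theorem mkQ_of_eq {g g' : Perm (Fin (n + 1))} (h : g⁻¹ (Fin.last n) = g'⁻¹ (Fin.last n)) :
    (augmentationMul (symSubalgebra n)).mkQ (MonoidAlgebra.of ℂ _ g) =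
      (augmentationMul (symSubalgebra n)).mkQ (MonoidAlgebra.of ℂ _ g') := by
  obtain ⟨σ, hσ⟩ := exists_symEmb_eq (g := g * g'⁻¹) (by rw [Perm.mul_apply, ← h]; simp)
  rw [Submodule.mkQ_apply, Submodule.mkQ_apply, Submodule.Quotient.eq]
  have : MonoidAlgebra.of ℂ _ g - MonoidAlgebra.of ℂ _ g' =
      (MonoidAlgebra.of ℂ _ (symEmb n σ) - 1) * MonoidAlgebra.of ℂ _ g' := by
    rw [sub_mul, ← map_mul, hσ, inv_mul_cancel_right, one_mul]
  rw [this]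
  refine Submodule.mul_mem_mul ⟨?_, ?_⟩ Submodule.mem_top
  · refine sub_mem ⟨MonoidAlgebra.of ℂ _ σ, ?_⟩ (one_mem (symSubalgebra n))
    simp
  · simp [MonoidAlgebra.one_def]

theorem swap_inv_last (x : Fin (n + 1)) :
    (swap x (Fin.last n))⁻¹ (Fin.last n) = x := by
  simp

/-- The module `V` is the permutation module `ℂ^{n+1}`. -/
noncomputable def cosetEquiv (n : ℕ) :
    (MonoidAlgebra ℂ (Perm (Fin (n + 1))) ⧸ augmentationMul (symSubalgebra n)) ≃ₗ[ℂ]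
      (Fin (n + 1) →₀ ℂ) :=
  LinearEquiv.ofLinearMap
    ((augmentationMul (symSubalgebra n)).liftQ (cosetPoint n) augmentationMul_le_ker)
    -- The transposition of `x` with the last point represents the coset attached to `x`.
    (Finsupp.lift _ ℂ _ fun x => (augmentationMul (symSubalgebra n)).mkQ
      (MonoidAlgebra.of ℂ _ (swap x (Fin.last n))))
    (by
      refine Finsupp.lhom_ext' fun x => LinearMap.ext_ring ?_
      simpa using cosetPoint_of (swap x (Fin.last n)))
    (by
      refine Submodule.linearMap_qext _ ((MonoidAlgebra.basis _ ℂ).ext fun g => ?_)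
      have h := cosetPoint_of g
      rw [MonoidAlgebra.of_apply] at h
      simp only [MonoidAlgebra.basis_apply, LinearMap.comp_apply, Submodule.mkQ_apply,
        Submodule.liftQ_apply, h, LinearMap.id_apply]
      simpa using mkQ_of_eq (swap_inv_last (g⁻¹ (Fin.last n))))

/-- The basis of `V` indexed by points. -/
noncomputable def cosetBasis (n : ℕ) : Basis (Fin (n + 1)) ℂ
    (MonoidAlgebra ℂ (Perm (Fin (n + 1))) ⧸ augmentationMul (symSubalgebra n)) :=
  ⟨cosetEquiv n⟩

theorem mkQ_of_eq_cosetBasis (g : Perm (Fin (n + 1))) :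
    (augmentationMul (symSubalgebra n)).mkQ (MonoidAlgebra.of ℂ _ g) =
      cosetBasis n (g⁻¹ (Fin.last n)) := by
  refine (LinearEquiv.eq_symm_apply _).2 ?_
  exact cosetPoint_of g

/-- Right multiplication by `g` turns `h⁻¹(n + 1)` into `g⁻¹h⁻¹(n + 1)`, so the opposite group acts
on points through inversion. -/
theorem symPerm_cosetBasis (g : (Perm (Fin (n + 1)))ᵐᵒᵖ) (x : Fin (n + 1)) :
    symPerm n g (cosetBasis n x) = cosetBasis n ((MulEquiv.inv' _).symm g x) := by
  obtain ⟨h, rfl⟩ : ∃ h : Perm (Fin (n + 1)), h⁻¹ (Fin.last n) = x := ⟨_, swap_inv_last x⟩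
  rw [← mkQ_of_eq_cosetBasis]
  have : symPerm n g ((augmentationMul (symSubalgebra n)).mkQ (MonoidAlgebra.of ℂ _ h)) =
      (augmentationMul (symSubalgebra n)).mkQ (MonoidAlgebra.of ℂ _ (h * g.unop)) := by
    rw [map_mul]
    rfl
  rw [this, mkQ_of_eq_cosetBasis]
  simp

theorem isMinModuleDepth_symPerm (n : ℕ) : IsMinModuleDepth (symPerm n) n := by
  let φ : (Perm (Fin (n + 1)))ᵐᵒᵖ →* Perm (Fin (n + 1)) :=
    (MulEquiv.inv' (Perm (Fin (n + 1)))).symm.toMonoidHom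
  have : Finite (Perm (Fin (n + 1)))ᵐᵒᵖ := Finite.of_equiv _ MulOpposite.opEquiv
  refine ⟨hasModuleDepth_of_trivial_stabilizer (b := cosetBasis n) (φ := φ)
    symPerm_cosetBasis Fin.castSucc fun g hg => ?_, fun m hm => ?_⟩
  · refine (MulEquiv.inv' (Perm (Fin (n + 1)))).symm.injective ?_
    rw [map_one]
    exact perm_eq_one_of_castSucc fun i => congrFun hg i
  · by_contra! hlt
    let p : Fin (m + 2) ↪ Fin (n + 1) := Fin.castLEEmb (by omega)
    refine not_hasModuleDepth_of_symmetric (b := cosetBasis n) (φ := φ) symPerm_cosetBasis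
      ((MulEquiv.inv' (Perm (Fin (n + 1)))).toMonoidHom.comp (Perm.viaEmbeddingHom p)) p
      (fun σ a => ?_) (fun σ x hx => ?_) hm
    · simpa [φ, Perm.viaEmbeddingHom_apply] using Perm.viaEmbedding_apply σ p a
    · simpa [φ, Perm.viaEmbeddingHom_apply] using Perm.viaEmbedding_apply_of_notMem σ p x hx

theorem isMinModuleDepth_symPermRes (hn : 1 ≤ n) : IsMinModuleDepth (symPermRes n) (n - 1) := by
  -- After this shift `S_{n+1}` acts on `n + 2` points, fixing the last, and the claimed depth is
  -- `n`.
  obtain ⟨n, rfl⟩ := Nat.exists_eq_add_of_le' hn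
  let φ : (Perm (Fin (n + 1)))ᵐᵒᵖ →* Perm (Fin (n + 2)) :=
    (symEmb (n + 1)).comp (MulEquiv.inv' (Perm (Fin (n + 1)))).symm.toMonoidHom
  have hφ : ∀ g x, symPermRes (n + 1) g (cosetBasis (n + 1) x) =
      cosetBasis (n + 1) (φ g x) := by
    intro g x
    refine (symPerm_cosetBasis _ x).trans ?_
    simp [φ]
  have : Finite (Perm (Fin (n + 1)))ᵐᵒᵖ := Finite.of_equiv _ MulOpposite.opEquiv
  refine ⟨hasModuleDepth_of_trivial_stabilizer (b := cosetBasis (n + 1)) (φ := φ)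
    hφ (fun i => i.castSucc.castSucc) fun g hg => ?_, fun m hm => ?_⟩
  · refine (MulEquiv.inv' (Perm (Fin (n + 1)))).symm.injective ?_
    rw [map_one]
    refine perm_eq_one_of_castSucc fun i => Fin.castSucc_injective _ ?_
    rw [← symEmb_castSucc]
    exact congrFun hg i
  · by_contra! hlt
    have hlt' : m < n := hlt
    let p : Fin (m + 2) ↪ Fin (n + 1) := Fin.castLEEmb (by omega)
    refine not_hasModuleDepth_of_symmetric (b := cosetBasis (n + 1)) (φ := φ) hφ
      ((MulEquiv.inv' (Perm (Fin (n + 1)))).toMonoidHom.comp (Perm.viaEmbeddingHom p))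
      (p.trans Fin.castSuccEmb) (fun σ a => ?_) (fun σ x hx => ?_) hm
    · have := symEmb_castSucc (Perm.viaEmbeddingHom p σ) (p a)
      rw [Perm.viaEmbeddingHom_apply, Perm.viaEmbedding_apply] at this
      simpa [φ, Perm.viaEmbeddingHom_apply] using this
    · refine Fin.lastCases (fun _ => ?_) (fun y hy => ?_) x hx
      · exact symEmb_last _
      · have hy' : y ∉ Set.range p := by
          rintro ⟨a, rfl⟩
          exact hy ⟨a, rfl⟩
        have := symEmb_castSucc (Perm.viaEmbeddingHom p σ) y
        rw [Perm.viaEmbeddingHom_apply, Perm.viaEmbedding_apply_of_notMem _ _ _ hy'] at this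
        simpa [φ, Perm.viaEmbeddingHom_apply] using this

end SymmetricGroup

/-! ### The bimodules `ℂ S_{n+1} ⊗ ⋯ ⊗ ℂ S_{n+1}` over `ℂ S_n` -/

/-! ### Partial products under changes of one factor -/

section PartialProd

variable {G : Type*} [Group G] {j : ℕ}

/-- Moving `c` across one tensor sign changes only the partial product that ends at that sign;
longer ones contain `c` either way. -/
theorem partialProd_update_mul (g : Fin (j + 1) → G) (i : Fin j) (c : G) (l : Fin (j + 2)) :
    Fin.partialProd (Function.update g i.castSucc (g i.castSucc * c)) l =
      Fin.partialProd (Function.update g i.succ (c * g i.succ)) l *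
        (if l = i.succ.castSucc then c else 1) := by
  induction l using Fin.induction with
  | zero =>
    have : (0 : Fin (j + 2)) ≠ i.succ.castSucc := by simp [Fin.ext_iff]
    rw [if_neg this, mul_one, Fin.partialProd_zero, Fin.partialProd_zero]
  | succ l ih =>
    rw [Fin.partialProd_succ, Fin.partialProd_succ, ih]
    have h1 : l.succ = i.succ.castSucc ↔ l = i.castSucc := by simp [Fin.ext_iff]
    have h2 : l.castSucc = i.succ.castSucc ↔ l = i.succ := by simp [Fin.ext_iff]
    have h3 : i.castSucc ≠ i.succ := (Fin.castSucc_lt_succ).ne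
    simp only [h1, h2]
    by_cases ha : l = i.castSucc
    · subst ha
      simp [h3, mul_assoc]
    · by_cases hb : l = i.succ
      · subst hb
        simp [h3.symm, mul_assoc]
      · simp [ha, hb]

theorem partialProd_update_zero (g : Fin (j + 1) → G) (a : G) (l : Fin (j + 1)) :
    Fin.partialProd (Function.update g 0 (a * g 0)) l.succ = a * Fin.partialProd g l.succ := by
  rw [Fin.partialProd_succ', Fin.partialProd_succ', Fin.tail_update_zero, Function.update_self,
    mul_assoc]

theorem partialProd_update_last (g : Fin (j + 1) → G) (a : G) (l : Fin (j + 1)) :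
    Fin.partialProd (Function.update g (Fin.last j) a) l.castSucc =
      Fin.partialProd g l.castSucc := by
  rw [← Fin.partialProd_init, ← Fin.partialProd_init, Fin.init_update_last]

end PartialProd

/-! ### Balanced powers compared with tuples of points and a group element -/

section Bimodule

variable {n j : ℕ}

/-- The points `g₀(n + 1)`, `g₀g₁(n + 1)`, … and the product `g₀ ⋯ gⱼ`. -/
def pathPoint (g : Fin (j + 1) → Perm (Fin (n + 1))) :
    (Fin j → Fin (n + 1)) × Perm (Fin (n + 1)) :=
  (fun i => Fin.partialProd g i.castSucc.succ (Fin.last n), Fin.partialProd g (Fin.last j).succ)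

/-- The one affected partial product gains a right factor `c`, invisible at the last point, and the
full product does not change. -/
theorem pathPoint_balanced (g : Fin (j + 1) → Perm (Fin (n + 1))) (i : Fin j)
    {c : Perm (Fin (n + 1))} (hc : c (Fin.last n) = Fin.last n) :
    pathPoint (Function.update g i.castSucc (g i.castSucc * c)) =
      pathPoint (Function.update g i.succ (c * g i.succ)) := by
  refine Prod.ext (funext fun l => ?_) ?_
  · simp only [pathPoint]
    rw [partialProd_update_mul, Perm.mul_apply]
    split_ifs
    · rw [hc]
    · rfl
  · simp only [pathPoint]
    rw [partialProd_update_mul, if_neg, mul_one]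
    simpa [Fin.ext_iff] using i.2.ne'

theorem pathPoint_left (g : Fin (j + 1) → Perm (Fin (n + 1))) (a : Perm (Fin (n + 1))) :
    pathPoint (Function.update g 0 (a * g 0)) =
      (a ∘ (pathPoint g).1, a * (pathPoint g).2) := by
  simp only [pathPoint, partialProd_update_zero]
  rfl

theorem pathPoint_right (g : Fin (j + 1) → Perm (Fin (n + 1))) (a : Perm (Fin (n + 1))) :
    pathPoint (Function.update g (Fin.last j) (g (Fin.last j) * a)) =
      ((pathPoint g).1, (pathPoint g).2 * a) := by
  simp only [pathPoint]
  refine Prod.ext (funext fun l => ?_) ?_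
  · simp only [← Fin.castSucc_succ, partialProd_update_last]
  · simp only [Fin.partialProd_succ, partialProd_update_last, Function.update_self, mul_assoc]

theorem exists_pathPoint_eq (t : Fin j → Fin (n + 1)) :
    ∃ g : Fin (j + 1) → Perm (Fin (n + 1)), pathPoint g = (t, 1) := by
  -- The desired partial products, starting and ending at `1`; the factors are their successive
  -- quotients.
  let h : Fin (j + 2) → Perm (Fin (n + 1)) :=
    Fin.cons 1 (Fin.snoc (fun i => swap (t i) (Fin.last n)) 1)
  have hh := Fin.partialProd_left_inv h
  have h0 : h 0 = 1 := rfl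
  rw [h0, one_smul] at hh
  refine ⟨fun i => (h i.castSucc)⁻¹ * h i.succ, Prod.ext (funext fun i => ?_) ?_⟩
  · simp only [pathPoint]
    rw [hh]
    simp [h]
  · simp only [pathPoint]
    rw [hh]
    simp [h]

/-- The basis of the tensor power of `ℂ S_{n+1}` indexed by tuples of permutations. -/
noncomputable abbrev groupTupleBasis (n j : ℕ) :
    Basis (Fin (j + 1) → Perm (Fin (n + 1))) ℂ
      (⨂[ℂ]^(j + 1) (MonoidAlgebra ℂ (Perm (Fin (n + 1))))) :=
  Basis.piTensorProduct fun _ => MonoidAlgebra.basis (Perm (Fin (n + 1))) ℂ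

theorem groupTupleBasis_apply (g : Fin (j + 1) → Perm (Fin (n + 1))) :
    groupTupleBasis n j g = PiTensorProduct.tprod ℂ fun i => MonoidAlgebra.of ℂ _ (g i) :=
  Basis.piTensorProduct_apply _ g

theorem update_of (g : Fin (j + 1) → Perm (Fin (n + 1))) (i : Fin (j + 1))
    (a : Perm (Fin (n + 1))) :
    Function.update (fun i => MonoidAlgebra.of ℂ _ (g i)) i (MonoidAlgebra.of ℂ _ a) =
      fun l => MonoidAlgebra.of ℂ _ (Function.update g i a l) := by
  funext l
  by_cases h : l = i
  · subst h; simp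
  · simp [h]

/-- The linear extension of `pathPoint` to the tensor power. -/
noncomputable def pathMapAux (n j : ℕ) :
    (⨂[ℂ]^(j + 1) (MonoidAlgebra ℂ (Perm (Fin (n + 1))))) →ₗ[ℂ]
      ((Fin j → Fin (n + 1)) × Perm (Fin (n + 1)) →₀ ℂ) :=
  (groupTupleBasis n j).constr ℂ fun g => Finsupp.single (pathPoint g) 1

theorem pathMapAux_tprod (g : Fin (j + 1) → Perm (Fin (n + 1))) :
    pathMapAux n j (PiTensorProduct.tprod ℂ fun i => MonoidAlgebra.of ℂ _ (g i)) =
      Finsupp.single (pathPoint g) 1 := by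
  rw [← groupTupleBasis_apply]
  exact (groupTupleBasis n j).constr_basis ℂ _ g

theorem balancedRel_le_ker : balancedRel (symSubalgebra n) j ≤
    LinearMap.ker (pathMapAux n j) := by
  refine Submodule.span_le.2 ?_
  rintro _ ⟨x, i, b, hb, rfl⟩
  -- By linearity in the tensor and in `b`, only group elements need checking.
  have key : pathMapAux n j ∘ₗ actAt j i.castSucc (LinearMap.mulRight ℂ b) =
      pathMapAux n j ∘ₗ actAt j i.succ (LinearMap.mulLeft ℂ b) := by
    refine (groupTupleBasis n j).ext fun g => ?_
    simp only [groupTupleBasis_apply, LinearMap.comp_apply, actAt_tprod,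
      LinearMap.mulRight_apply, LinearMap.mulLeft_apply]
    refine symSubalgebra_induction (p := fun b =>
      pathMapAux n j (PiTensorProduct.tprod ℂ (Function.update
        (fun i => MonoidAlgebra.of ℂ _ (g i)) i.castSucc
          (MonoidAlgebra.of ℂ _ (g i.castSucc) * b))) =
      pathMapAux n j (PiTensorProduct.tprod ℂ (Function.update
        (fun i => MonoidAlgebra.of ℂ _ (g i)) i.succ
          (b * MonoidAlgebra.of ℂ _ (g i.succ)))))
      (fun σ => ?_) (fun y z hy hz => ?_) (fun c y hy => ?_) hb
    · rw [← map_mul, ← map_mul, update_of, update_of, pathMapAux_tprod, pathMapAux_tprod,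
        pathPoint_balanced g i (symEmb_last σ)]
    · simp only [mul_add, add_mul, MultilinearMap.map_update_add, map_add, hy, hz]
    · simp only [mul_smul_comm, smul_mul_assoc, MultilinearMap.map_update_smul, map_smul, hy]
  have := LinearMap.congr_fun key (PiTensorProduct.tprod ℂ x)
  simp only [LinearMap.comp_apply, actAt_tprod, LinearMap.mulRight_apply,
    LinearMap.mulLeft_apply] at this
  rw [SetLike.mem_coe, LinearMap.mem_ker, map_sub, this, sub_self]

/-- The linear extension of `pathPoint` to the balanced tensor power. -/
noncomputable def pathMap (n j : ℕ) : BalancedPower (symSubalgebra n) j →ₗ[ℂ]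
    ((Fin j → Fin (n + 1)) × Perm (Fin (n + 1)) →₀ ℂ) :=
  (balancedRel (symSubalgebra n) j).liftQ (pathMapAux n j) balancedRel_le_ker

/-- The class of a tuple of permutations in the balanced tensor power. -/
noncomputable def groupTuple (g : Fin (j + 1) → Perm (Fin (n + 1))) :
    BalancedPower (symSubalgebra n) j :=
  BalancedPower.mk _ j fun i => MonoidAlgebra.of ℂ _ (g i)

theorem pathMap_groupTuple (g : Fin (j + 1) → Perm (Fin (n + 1))) :
    pathMap n j (groupTuple g) = Finsupp.single (pathPoint g) 1 :=
  pathMapAux_tprod g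

theorem leftAct_groupTuple (g : Fin (j + 1) → Perm (Fin (n + 1))) (a : Perm (Fin (n + 1))) :
    leftAct (symSubalgebra n) j (MonoidAlgebra.of ℂ _ a) (groupTuple g) =
      groupTuple (Function.update g 0 (a * g 0)) := by
  refine (leftMul_mk _ _ _ _).trans ?_
  rw [← map_mul, update_of]
  rfl

theorem rightAct_groupTuple (g : Fin (j + 1) → Perm (Fin (n + 1))) (a : Perm (Fin (n + 1))) :
    rightAct (symSubalgebra n) j (MulOpposite.op (MonoidAlgebra.of ℂ _ a)) (groupTuple g) =
      groupTuple (Function.update g (Fin.last j) (g (Fin.last j) * a)) := by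
  refine (rightMul_mk _ _ _ _).trans ?_
  rw [MulOpposite.unop_op, ← map_mul, update_of]
  rfl

theorem span_range_groupTuple : Submodule.span ℂ (Set.range
    (groupTuple : (Fin (j + 1) → Perm (Fin (n + 1))) → _)) = ⊤ := by
  have h := congrArg (Submodule.map (balancedRel (symSubalgebra n) j).mkQ)
    (groupTupleBasis n j).span_eq
  rw [Submodule.map_span, Submodule.map_top, Submodule.range_mkQ, ← Set.range_comp] at h
  refine Eq.trans ?_ h
  congr 2
  funext g
  rw [Function.comp_apply, groupTupleBasis_apply]
  rfl

theorem tmul_smul (x : MonoidAlgebra ℂ (Perm (Fin (n + 1))))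
    (y : (MonoidAlgebra ℂ (Perm (Fin (n + 1))))ᵐᵒᵖ) (z : BalancedPower (symSubalgebra n) j) :
    (x ⊗ₜ[ℂ] y) • z = leftAct (symSubalgebra n) j x (rightAct (symSubalgebra n) j y z) := by
  change Algebra.TensorProduct.lift (leftAct (symSubalgebra n) j) (rightAct (symSubalgebra n) j)
      (leftAct_commute_rightAct (symSubalgebra n) j) (x ⊗ₜ[ℂ] y) z = _
  rw [Algebra.TensorProduct.lift_tmul]
  rfl

instance (j : ℕ) : IsScalarTower ℂ
    (MonoidAlgebra ℂ (Perm (Fin (n + 1))) ⊗[ℂ] (MonoidAlgebra ℂ (Perm (Fin (n + 1))))ᵐᵒᵖ)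
    (BalancedPower (symSubalgebra n) j) where
  smul_assoc c s z := by
    change Algebra.TensorProduct.lift (leftAct (symSubalgebra n) j) (rightAct (symSubalgebra n) j)
      (leftAct_commute_rightAct (symSubalgebra n) j) (c • s) z =
      c • Algebra.TensorProduct.lift (leftAct (symSubalgebra n) j) (rightAct (symSubalgebra n) j)
        (leftAct_commute_rightAct (symSubalgebra n) j) s z
    rw [map_smul]
    rfl

/-- The basis of the enveloping algebra indexed by pairs of permutations. -/
noncomputable def envelopingBasis (n : ℕ) : Basis (Perm (Fin (n + 1)) × Perm (Fin (n + 1))) ℂ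
    (MonoidAlgebra ℂ (Perm (Fin (n + 1))) ⊗[ℂ] (MonoidAlgebra ℂ (Perm (Fin (n + 1))))ᵐᵒᵖ) :=
  (MonoidAlgebra.basis _ ℂ).tensorProduct
    ((MonoidAlgebra.basis _ ℂ).map (MulOpposite.opLinearEquiv ℂ))

theorem envelopingBasis_apply (g h : Perm (Fin (n + 1))) : envelopingBasis n (g, h) =
    MonoidAlgebra.of ℂ _ g ⊗ₜ MulOpposite.op (MonoidAlgebra.of ℂ _ h) := by
  simp [envelopingBasis]

/-- The enveloping algebra is a quotient of the group algebra of `S_{n+1} × S_{n+1}ᵒᵖ`, to which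
Maschke's theorem applies. -/
instance (n : ℕ) : IsSemisimpleRing
    (MonoidAlgebra ℂ (Perm (Fin (n + 1))) ⊗[ℂ] (MonoidAlgebra ℂ (Perm (Fin (n + 1))))ᵐᵒᵖ) := by
  have : Finite (Perm (Fin (n + 1)))ᵐᵒᵖ := Finite.of_equiv _ MulOpposite.opEquiv
  have : NeZero (Nat.card (Perm (Fin (n + 1)) × (Perm (Fin (n + 1)))ᵐᵒᵖ) : ℂ) :=
    ⟨Nat.cast_ne_zero.2 Nat.card_pos.ne'⟩
  let θ : Perm (Fin (n + 1)) × (Perm (Fin (n + 1)))ᵐᵒᵖ →*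
      MonoidAlgebra ℂ (Perm (Fin (n + 1))) ⊗[ℂ] (MonoidAlgebra ℂ (Perm (Fin (n + 1))))ᵐᵒᵖ :=
    { toFun g := MonoidAlgebra.of ℂ _ g.1 ⊗ₜ MulOpposite.op (MonoidAlgebra.of ℂ _ g.2.unop)
      map_one' := by
        rw [Prod.fst_one, Prod.snd_one, MulOpposite.unop_one, map_one, MulOpposite.op_one]
        rfl
      map_mul' g h := by
        rw [Algebra.TensorProduct.tmul_mul_tmul, ← MulOpposite.op_mul, ← map_mul, ← map_mul]
        rfl }
  refine RingHom.isSemisimpleRing_of_surjective (MonoidAlgebra.lift ℂ _ _ θ).toRingHom ?_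
  have h : LinearMap.range (MonoidAlgebra.lift ℂ _ _ θ).toLinearMap = ⊤ := by
    rw [← top_le_iff, ← (envelopingBasis n).span_eq, Submodule.span_le]
    rintro _ ⟨⟨g, h⟩, rfl⟩
    refine ⟨MonoidAlgebra.of ℂ _ (g, MulOpposite.op h), ?_⟩
    rw [envelopingBasis_apply]
    exact MonoidAlgebra.lift_of _ _
  exact LinearMap.range_eq_top.1 h

instance (j : ℕ) : Module.Finite
    (MonoidAlgebra ℂ (Perm (Fin (n + 1))) ⊗[ℂ] (MonoidAlgebra ℂ (Perm (Fin (n + 1))))ᵐᵒᵖ)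
    (BalancedPower (symSubalgebra n) j) := by
  have : Module.Finite ℂ (BalancedPower (symSubalgebra n) j) :=
    ⟨Submodule.fg_def.2 ⟨_, Set.finite_range _, span_range_groupTuple⟩⟩
  exact Module.Finite.of_restrictScalars_finite ℂ _ _

/-- With at least `n` signs `⊗`, the balanced tensor power contains a free cyclic bimodule. -/
theorem exists_injective_smul (hj : n ≤ j) : ∃ z : BalancedPower (symSubalgebra n) j,
    Function.Injective fun r : MonoidAlgebra ℂ (Perm (Fin (n + 1))) ⊗[ℂ]
      (MonoidAlgebra ℂ (Perm (Fin (n + 1))))ᵐᵒᵖ => r • z := by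
  obtain ⟨g, hg⟩ := exists_pathPoint_eq (n := n) (j := j)
    -- The first `n` entries are distinct points; any further entries are padding by the last point.
    fun i => ⟨min i n, by omega⟩
  refine ⟨groupTuple g, ?_⟩
  let f := pathMap n j ∘ₗ (LinearMap.toSpanSingleton (MonoidAlgebra ℂ (Perm (Fin (n + 1))) ⊗[ℂ]
      (MonoidAlgebra ℂ (Perm (Fin (n + 1))))ᵐᵒᵖ) _ (groupTuple g)).restrictScalars ℂ
  suffices hf : Function.Injective f from Function.Injective.of_comp (f := pathMap n j) hf
  refine LinearMap.injective_of_linearIndependent (envelopingBasis n).span_eq ?_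
  have : f ∘ envelopingBasis n = Finsupp.basisSingleOne ∘
      fun a : Perm (Fin (n + 1)) × Perm (Fin (n + 1)) =>
        (a.1 ∘ (pathPoint g).1, a.1 * (pathPoint g).2 * a.2) := by
    funext ⟨a, b⟩
    simp only [f, Function.comp_apply, LinearMap.comp_apply, LinearMap.restrictScalars_apply,
      LinearMap.toSpanSingleton_apply, envelopingBasis_apply, tmul_smul, rightAct_groupTuple,
      leftAct_groupTuple, pathMap_groupTuple, pathPoint_left, pathPoint_right,
      Finsupp.coe_basisSingleOne, mul_assoc]
  rw [this]
  -- The first `n` translated points determine `a`, and then the product `ab` determines `b`.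
  refine Finsupp.basisSingleOne.linearIndependent.comp _ ?_
  rintro ⟨a, b⟩ ⟨a', b'⟩ hab
  rw [hg] at hab
  obtain ⟨h1, h2⟩ := Prod.mk.inj hab
  have ha : a'⁻¹ * a = 1 := perm_eq_one_of_castSucc fun i => by
    have := congrFun h1 ⟨i, by omega⟩
    have hi : (⟨min i n, by omega⟩ : Fin (n + 1)) = i.castSucc := by
      simp [Fin.ext_iff, i.2.le]
    simp only [Function.comp_apply, hi] at this
    rw [Perm.mul_apply, this]
    simp
  obtain rfl := inv_mul_eq_one.1 ha
  simpa using h2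

/-- A permutation fixing all points of a tuple passes through all tensor factors. -/
theorem groupTuple_conj (g : Fin (j + 1) → Perm (Fin (n + 1))) {τ : Perm (Fin (n + 1))}
    (hτ : ∀ i, τ ((pathPoint g).1 i) = (pathPoint g).1 i) (l : Fin (j + 1)) :
    groupTuple (Function.update g 0 (τ * g 0)) =
      groupTuple (Function.update g l
        ((Fin.partialProd g l.castSucc)⁻¹ * τ * Fin.partialProd g l.castSucc * g l)) := by
  induction l using Fin.induction with
  | zero => simp
  | succ i ih =>
    rw [ih]
    -- Since `τ` fixes the path point at this sign, its conjugate by the partial product fixes the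
    -- last point, so it lies in `S_n` and may cross the sign.
    obtain ⟨c, hc⟩ : ∃ c, symEmb n c = (Fin.partialProd g i.succ.castSucc)⁻¹ * τ *
        Fin.partialProd g i.succ.castSucc := exists_symEmb_eq (by
      have := hτ i
      simp only [pathPoint] at this
      simp [this])
    have h1 : (Fin.partialProd g i.castSucc.castSucc)⁻¹ * τ *
        Fin.partialProd g i.castSucc.castSucc * g i.castSucc = g i.castSucc * symEmb n c := by
      rw [hc, Fin.castSucc_succ, Fin.partialProd_succ]
      group
    rw [h1, ← hc]
    refine (Submodule.Quotient.eq _).2 (Submodule.subset_span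
      ⟨fun i => MonoidAlgebra.of ℂ _ (g i), i, MonoidAlgebra.of ℂ _ (symEmb n c),
        ⟨MonoidAlgebra.of ℂ _ c, by simp⟩, ?_⟩)
    rw [← map_mul, ← map_mul, update_of, update_of]

/-- The sum of all permutations. -/
noncomputable def groupSum (n : ℕ) : MonoidAlgebra ℂ (Perm (Fin (n + 1))) :=
  ∑ h, MonoidAlgebra.of ℂ _ h

theorem rightAct_groupSum (g : Fin (j + 1) → Perm (Fin (n + 1))) :
    rightAct (symSubalgebra n) j (MulOpposite.op (groupSum n)) (groupTuple g) =
      ∑ h, groupTuple (Function.update g (Fin.last j) h) := by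
  rw [groupSum, Finset.op_sum, map_sum, LinearMap.sum_apply]
  simp only [rightAct_groupTuple]
  exact Fintype.sum_equiv (Equiv.mulLeft (g (Fin.last j))) _ _ fun h => rfl

/-- Pushed through to the last factor, `τ` is absorbed by the sum over all permutations. This gives
the vanishing below without injectivity of `pathMap`. -/
theorem leftAct_rightAct_groupSum (g : Fin (j + 1) → Perm (Fin (n + 1)))
    {τ : Perm (Fin (n + 1))} (hτ : ∀ i, τ ((pathPoint g).1 i) = (pathPoint g).1 i) :
    leftAct (symSubalgebra n) j (MonoidAlgebra.of ℂ _ τ)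
        (rightAct (symSubalgebra n) j (MulOpposite.op (groupSum n)) (groupTuple g)) =
      rightAct (symSubalgebra n) j (MulOpposite.op (groupSum n)) (groupTuple g) := by
  have h := LinearMap.congr_fun (leftAct_commute_rightAct (symSubalgebra n) j
    (MonoidAlgebra.of ℂ _ τ) (MulOpposite.op (groupSum n))).eq (groupTuple g)
  rw [Module.End.mul_apply, Module.End.mul_apply] at h
  rw [h, leftAct_groupTuple, groupTuple_conj g hτ (Fin.last j), rightAct_groupSum,
    rightAct_groupSum]
  simp

theorem not_dividesMultiple_balancedPower (hj : j < n) : ¬ DividesMultiple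
    (MonoidAlgebra ℂ (Perm (Fin (n + 1))) ⊗[ℂ] (MonoidAlgebra ℂ (Perm (Fin (n + 1))))ᵐᵒᵖ)
    (BalancedPower (symSubalgebra n) (j + 1)) (BalancedPower (symSubalgebra n) j) := by
  intro hd
  let p : Fin (j + 2) ↪ Fin (n + 1) := Fin.castLEEmb (by omega)
  let ψ := Perm.viaEmbeddingHom p
  have hp : ∀ σ a, ψ σ (p a) = p (σ a) := fun σ a => Perm.viaEmbedding_apply σ p a
  have hx : ∀ σ, ∀ x ∉ Set.range p, ψ σ x = x :=
    fun σ x hx => Perm.viaEmbedding_apply_of_notMem σ p x hx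
  obtain ⟨g, hg⟩ := exists_pathPoint_eq (n := n) fun l : Fin (j + 1) => p l.castSucc
  have h0 := hd.smul_eq_zero
    -- This element kills the power with `j` signs but not a path through `j + 1` of the `j + 2`
    -- chosen points.
    (a := antisymmetrizer ℂ ψ ⊗ₜ MulOpposite.op (groupSum n)) ?_ (groupTuple g)
  · have h1 := congrArg (fun z => pathMap n (j + 1) z (pathPoint g)) h0
    simp only [tmul_smul, antisymmetrizer, groupSum, Finset.op_sum, map_sum,
      LinearMap.sum_apply, rightAct_groupTuple, map_smul, LinearMap.smul_apply,
      leftAct_groupTuple, pathMap_groupTuple, pathPoint_left, pathPoint_right,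
      Finsupp.finsetSum_apply, Finsupp.smul_apply, map_zero, Finsupp.zero_apply] at h1
    -- In the coefficient at the path of `g`, equality of points forces `σ = 1`, and equality of
    -- products then forces `h = 1`.
    rw [Finset.sum_eq_single 1, Finset.sum_eq_single 1] at h1
    · simp at h1
    · intro σ _ hσ
      rw [Finsupp.single_eq_of_ne, smul_zero]
      intro hc
      refine hσ (perm_eq_one_of_castSucc fun l => p.injective ?_)
      have := congrFun (congrArg Prod.fst hc) l
      rw [hg] at this
      rw [← hp]
      exact this.symm
    · simp
    · intro h _ hh
      refine Finset.sum_eq_zero fun σ _ => ?_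
      rw [Finsupp.single_eq_of_ne, smul_zero]
      intro hc
      have hσ : σ = 1 := perm_eq_one_of_castSucc fun l => p.injective (by
        have := congrFun (congrArg Prod.fst hc) l
        rw [hg] at this
        rw [← hp]
        exact this.symm)
      have := congrArg Prod.snd hc
      rw [hg, hσ] at this
      exact hh (by simpa using this.symm)
    · simp
  · intro z
    have hz : z ∈ Submodule.span ℂ (Set.range
        (groupTuple : (Fin (j + 1) → Perm (Fin (n + 1))) → _)) := by
      rw [span_range_groupTuple]; trivial
    induction hz using Submodule.span_induction with
    | mem z hz =>
      obtain ⟨g, rfl⟩ := hz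
      obtain ⟨x, y, hxy, hx', hy'⟩ := exists_ne_notMem_range le_rfl p (pathPoint g).1
      rw [tmul_smul]
      exact antisymmetrizer_apply_eq_zero ψ hxy _
        (leftAct_rightAct_groupSum g fun l => swap_fixes ψ hp hx hx' hy' l)
    | zero => exact smul_zero _
    | add x y _ _ hx hy => rw [smul_add, hx, hy, add_zero]
    | smul c x _ hx => rw [tmul_smul] at hx ⊢; rw [map_smul, map_smul, hx, smul_zero]

theorem isMinHDepth_symSubalgebra (n : ℕ) : IsMinHDepth (symSubalgebra n) (2 * n + 1) := by
  refine ⟨⟨n, rfl, ?_, ?_⟩, ?_⟩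
  -- The powers with `n` and `n + 1` signs both contain a free cyclic bimodule, so each divides a
  -- multiple of the other.
  · obtain ⟨z, hz⟩ := exists_injective_smul (n := n) le_rfl
    exact dividesMultiple_of_injective_smul z hz
  · obtain ⟨z, hz⟩ := exists_injective_smul (n := n) (Nat.le_succ n)
    exact dividesMultiple_of_injective_smul z hz
  · rintro _ ⟨j, rfl, hj, -⟩
    by_contra! hlt
    exact not_dividesMultiple_balancedPower (by omega) hj

end Bimodule

end SubalgebraDepth

theorem mainTheorem11 (n : ℕ) (hn : 1 ≤ n) :
    SubalgebraDepth.IsMinHDepth (SubalgebraDepth.symSubalgebra n) (2 * n + 1) ∧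
    SubalgebraDepth.IsMinModuleDepth (SubalgebraDepth.symPermRes n) (n - 1) ∧
    SubalgebraDepth.IsMinModuleDepth (SubalgebraDepth.symPerm n) n :=
  ⟨SubalgebraDepth.isMinHDepth_symSubalgebra n, SubalgebraDepth.isMinModuleDepth_symPermRes hn,
    SubalgebraDepth.isMinModuleDepth_symPerm n⟩
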